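/- **Uniqueness of the very weak solution, case I: $V\ge 0$.** Let $\mathbb G$ be a connected, simply connected graded Lie group (gradation $\mathfrak g=\bigoplus_{k\ge1}\mathfrak g_k$, $[\mathfrak g_j,\mathfrak g_k]\subset\mathfrak g_{j+k}$) with dilations $D_r$, homogeneous dimension $Q$ and a Haar measure, and let $\mathcal R$ be a positive Rockland operator on $\mathbb G$ of homogeneous degree $\nu$; write $\mathcal R$ also for its self-adjoint extension on $L^2(\mathbb G)$ (the closure from $\mathcal D(\mathbb G)$), and $\|f\|_{H^{\nu/2}}=\|\mathcal R^{1/2}f\|_{L^2}+\|f\|_{L^2}$. Let $T>0$ and let $\omega:(0,1]\to(0,\infty)$ with $\omega(\epsilon)\to0$ as $\epsilon\to0$. A net $(f_\epsilon)_{\epsilon\in(0,1]}$ in a normed space $X$ is $X$-moderate if, for some $N\in\mathbb N$ and $C$, $\|f_\epsilon\|_X\le C\omega(\epsilon)^{-N}$ for all $\epsilon\in(0,1]$; it is $X$-negligible if for every $k\in\mathbb N$ there is $C_k$ with $\|f_\epsilon\|_X\le C_k\,\omega(\epsilon)^k$ for all $\epsilon\in(0,1]$. A regularisation of a distribution $v$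 is a net $v*\psi_\epsilon$, $\psi_\epsilon(x)=\theta(\epsilon)^{-Q}\psi(D_{\theta(\epsilon)^{-1}}x)$, with $\psi\in C_c^\infty(\mathbb G)$, $\int\psi=1$, and $\theta:(0,1]\to(0,\infty)$, $\theta(\epsilon)\to0$ as $\epsilon\to 0$. For $u_0\in L^2(\mathbb G)$ and a function $V$, a solution of $$\partial_tu+\mathcal Ru+Vu=0\ \text{ on }[0,T]\times\mathbb G,\qquad u(0,\cdot)=u_0,\tag{1}$$ is a $u\in C([0,T];H^{\nu/2}(\mathbb G))\cap C^1((0,T];L^2(\mathbb G))$ with $u(0)=u_0$ such that, for all $t\in(0,T]$, $u(t)\in\mathrm{Dom}(\mathcal R)$ and the equation holds in $L^2(\mathbb G)$. For normed spaces $X,Y$ of functions on $\mathbb G$ and distributions $V\ge0$ and $u_0$ on $\mathbb G$, the very weak solution of the Cauchy problem (1) with data $V,u_0$ is called $(X,Y)$-unique if the following holds. Let $(V_\epsilon)$, $(\tilde V_\epsilon)$ be any $X$-moderate nets of nonnegative functions (not required to approximate $V$) such that $(V_\epsilon-\tilde V_\epsilon)$ is $Y$-negligible. Let $(u_{0,\epsilon})$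 be an $H^{\nu/2}$-moderate regularisation of $u_0$ and $(\tilde u_{0,\epsilon})$ any $H^{\nu/2}$-moderate net (for example another regularisation of $u_0$) such that $(u_{0,\epsilon}-\tilde u_{0,\epsilon})$ is $L^2$-negligible. Let $u_\epsilon$, $\tilde u_\epsilon$ be solutions of (1) with $(V,u_0)$ replaced by $(V_\epsilon,u_{0,\epsilon})$ and $(\tilde V_\epsilon,\tilde u_{0,\epsilon})$, respectively. Then $(u_\epsilon-\tilde u_\epsilon)$ is $L^2$-negligible uniformly in $t\in[0,T]$: for every $k$ there is $C_k$ with $\sup_{t\in[0,T]}\|u_\epsilon(t)-\tilde u_\epsilon(t)\|_{L^2}\le C_k\,\omega(\epsilon)^k$ for all $\epsilon\in(0,1]$. **Theorem.** Let $V\ge0$ and $u_0\in H^{\nu/2}(\mathbb G)\cup\mathcal E'(\mathbb G)$. 1. If $V\in L^\infty(\mathbb G)\cup\mathcal E'(\mathbb G)$, then the very weak solution of the Cauchy problem (1) is $(L^\infty(\mathbb G),L^\infty(\mathbb G))$-unique. 2. If $Q>\nu$ and $V\in L^\infty(\mathbb G)\cup\mathcal E'(\mathbb G)$ or $V\in L^{Q/\nu}(\mathbb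 G)\cap L^{2Q/\nu}(\mathbb G)$, then it is $(L^{Q/\nu}(\mathbb G)\cap L^{2Q/\nu}(\mathbb G),\,L^\infty(\mathbb G))$-unique. -/

import Mathlib

open MeasureTheory Filter Set
open scoped Manifold ContDiff Topology ENNReal ComplexConjugate ComplexOrder

noncomputable section

section GradedGroup

variable {n : ℕ} {G : Type*} [TopologicalSpace G] [ChartedSpace (EuclideanSpace ℝ (Fin n)) G]
  [Group G]

variable (n G) in
/-- A gradation `𝔤 = ⨁_{k ≥ 1} 𝔤_k`, `[𝔤_j, 𝔤_k] ⊆ 𝔤_{j+k}`, of the Lie algebra of an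
`n`-dimensional Lie group `G`, presented by an adapted basis: `𝔤_k` is the span of the basis
vectors of weight `k`. -/
structure Gradation where
  /-- the dilation weights `ν_1, …, ν_n` -/
  weight : Fin n → ℕ
  weight_pos : ∀ i, 0 < weight i
  /-- the adapted basis `X_1, …, X_n` -/
  basis : Module.Basis (Fin n) ℝ (GroupLieAlgebra (𝓡 n) G)
  bracket_mem : ∀ i j, ⁅basis i, basis j⁆ ∈
    Submodule.span ℝ (basis '' {k | weight k = weight i + weight j})

/-- The homogeneous dimension `Q = ν_1 + ⋯ + ν_n`. -/
def Gradation.homDim (gr : Gradation n G) : ℕ := ∑ i, gr.weight i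

/-- `D` is the dilation `D_r` of the group: the smooth group endomorphism whose differential at
the identity multiplies `X_i` by `r ^ ν_i`. -/
def Gradation.IsDilation (gr : Gradation n G) (r : ℝ) (D : G → G) : Prop :=
  (∀ x y, D (x * y) = D x * D y) ∧ ContMDiff (𝓡 n) (𝓡 n) ∞ D ∧
    ∀ i, mfderiv (𝓡 n) (𝓡 n) D 1 (gr.basis i) =
      (r ^ gr.weight i • gr.basis i : GroupLieAlgebra (𝓡 n) G)

open Classical in
/-- The dilation `D_r`, which exists and is unique when `G` is connected and simply connected. -/
def Gradation.dilation (gr : Gradation n G) (r : ℝ) : G → G :=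
  if h : ∃ D : G → G, gr.IsDilation r D then h.choose else id

/-- The derivative of `f : G → ℂ` along the left-invariant vector field of `X`. -/
def leftDeriv (X : GroupLieAlgebra (𝓡 n) G) (f : G → ℂ) (x : G) : ℂ :=
  mfderiv (𝓡 n) 𝓘(ℝ, ℂ) f x (mulInvariantVectorField X x)

/-- The left-invariant differential operator `X^α = X_1 ^ α_1 ⋯ X_n ^ α_n`. -/
def Gradation.monomialOp (gr : Gradation n G) (α : Fin n →₀ ℕ) (f : G → ℂ) : G → ℂ :=
  (List.finRange n).foldr (fun i g => (leftDeriv (gr.basis i))^[α i] g) f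

/-- The left-invariant differential operator `∑ c_α X^α`. -/
def Gradation.diffOp (gr : Gradation n G) (c : (Fin n →₀ ℕ) →₀ ℂ) (f : G → ℂ) (x : G) : ℂ :=
  c.sum fun α a => a * gr.monomialOp α f x

section Representations

variable {W : Type} [NormedAddCommGroup W] [InnerProductSpace ℂ W]

/-- A nontrivial irreducible strongly continuous unitary representation of `G` on `W`. -/
def IsNontrivialIrrep (π : G →* (W ≃ₗᵢ[ℂ] W)) : Prop :=
  (∀ v, Continuous fun x => π x v) ∧
  (∃ v : W, v ≠ 0) ∧
  (∀ K : Submodule ℂ W, IsClosed (K : Set W) → (∀ x, ∀ v ∈ K, π x v ∈ K) → K = ⊥ ∨ K = ⊤) ∧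
  ∃ x v, π x v ≠ v

variable (n) in
/-- Smooth vectors of a representation. -/
def IsSmoothVector (π : G →* (W ≃ₗᵢ[ℂ] W)) (v : W) : Prop :=
  ContMDiff (𝓡 n) 𝓘(ℝ, W) ∞ fun x => π x v

/-- The infinitesimal representation `π(X)`, on smooth vectors. -/
def infRep (π : G →* (W ≃ₗᵢ[ℂ] W)) (X : GroupLieAlgebra (𝓡 n) G) (v : W) : W :=
  mfderiv (𝓡 n) 𝓘(ℝ, W) (fun x => π x v) 1 X

/-- `∑ c_α π(X_1) ^ α_1 ⋯ π(X_n) ^ α_n`, on smooth vectors. -/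
def Gradation.infRepOp (gr : Gradation n G) (π : G →* (W ≃ₗᵢ[ℂ] W)) (c : (Fin n →₀ ℕ) →₀ ℂ)
    (v : W) : W :=
  c.sum fun α a => a • (List.finRange n).foldr (fun i w => (infRep π (gr.basis i))^[α i] w) v

end Representations

/-- Smooth compactly supported functions `φ : G → ℂ`. -/
def IsTestFunction (φ : G → ℂ) : Prop :=
  ContMDiff (𝓡 n) 𝓘(ℝ, ℂ) ∞ φ ∧ HasCompactSupport φ

variable (n G) in
/-- The space `𝒟(G)` of test functions. -/
def testFunctions : Submodule ℂ (G → ℂ) where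
  carrier := {φ | IsTestFunction (n := n) φ}
  zero_mem' := ⟨contMDiff_const, HasCompactSupport.zero⟩
  add_mem' := fun ha hb => ⟨ha.1.add hb.1, ha.2.add hb.2⟩
  smul_mem' := fun c _ ha => ⟨(contDiff_const.mul contDiff_id).contMDiff.comp ha.1, ha.2.mul_left (f := fun _ => c)⟩

/-- A Rockland operator `∑_{[α] = ν} c_α X^α`, homogeneous of degree `ν > 0`, injective on the
smooth vectors of every nontrivial irreducible unitary representation, and positive:
`∫ (ℛ φ) φ̄ ≥ 0` for all test functions. The representations of a second countable group act on
separable Hilbert spaces, so that spaces in `Type` suffice. -/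
structure PositiveRockland [MeasurableSpace G] (gr : Gradation n G) (μ : Measure G) where
  coeff : (Fin n →₀ ℕ) →₀ ℂ
  /-- the homogeneous degree `ν` -/
  degree : ℕ
  degree_pos : 0 < degree
  homogeneous : ∀ α ∈ coeff.support, ∑ i, gr.weight i * α i = degree
  rockland : ∀ (W : Type) [NormedAddCommGroup W] [InnerProductSpace ℂ W] [CompleteSpace W]
    (π : G →* (W ≃ₗᵢ[ℂ] W)), IsNontrivialIrrep π →
    ∀ v, IsSmoothVector n π v → gr.infRepOp π coeff v = 0 → v = 0
  positive : ∀ φ ∈ testFunctions n G, 0 ≤ ∫ x, gr.diffOp coeff φ x * conj (φ x) ∂μ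

/-! ### The operator on `L²` and the Sobolev norm -/

section L2

variable [MeasurableSpace G] {μ : Measure G} {gr : Gradation n G}

/-- The graph of the self-adjoint extension of `ℛ` on `L²(G)`, i.e. of the closure of `ℛ` on
`𝒟(G)` (where `ℛ` is essentially self-adjoint). -/
def PositiveRockland.graph (R : PositiveRockland gr μ) : Set (Lp ℂ 2 μ × Lp ℂ 2 μ) :=
  closure {p | ∃ φ ∈ testFunctions n G, p.1 =ᵐ[μ] φ ∧ p.2 =ᵐ[μ] gr.diffOp R.coeff φ}

/-- `S` is the positive self-adjoint square root of the operator with graph `A`. -/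
def IsPositiveSqrt (A : Set (Lp ℂ 2 μ × Lp ℂ 2 μ)) (S : Lp ℂ 2 μ →ₗ.[ℂ] Lp ℂ 2 μ) : Prop :=
  Dense (S.domain : Set (Lp ℂ 2 μ)) ∧ IsSelfAdjoint S ∧
  (∀ f : S.domain, 0 ≤ inner ℂ (f : Lp ℂ 2 μ) (S f)) ∧
  ∀ f h, (f, h) ∈ A ↔ ∃ g, (f, g) ∈ S.graph ∧ (g, h) ∈ S.graph

open Classical in
/-- The operator `ℛ^{1/2}`, the (unique) positive self-adjoint square root of `ℛ`. -/
def PositiveRockland.sqrtOp (R : PositiveRockland gr μ) : Lp ℂ 2 μ →ₗ.[ℂ] Lp ℂ 2 μ :=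
  if h : ∃ S, IsPositiveSqrt R.graph S then h.choose else ⊥

open Classical in
/-- The norm `‖ℛ^{1/2} f‖ + ‖f‖` of `H^{ν/2}(G)`, with value `∞` outside `H^{ν/2}(G)`. -/
def PositiveRockland.sobolevNorm (R : PositiveRockland gr μ) (f : Lp ℂ 2 μ) : ℝ≥0∞ :=
  if h : f ∈ R.sqrtOp.domain then ‖R.sqrtOp ⟨f, h⟩‖ₑ + ‖f‖ₑ else ⊤

/-- `u` solves `∂_t u + ℛ u + V u = 0` on `[0, T]`, `u(0) = u₀`, with `u ∈ C([0,T]; H^{ν/2}(G))`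
and `u ∈ C¹((0,T]; L²(G))`; the equation is an identity in `L²(G)` for all `t ∈ (0, T]`. -/
def PositiveRockland.IsSolution (R : PositiveRockland gr μ) (T : ℝ) (V : G → ℝ)
    (u₀ : Lp ℂ 2 μ) (u : ℝ → Lp ℂ 2 μ) : Prop :=
  u 0 = u₀ ∧
  (∀ t ∈ Icc 0 T, R.sobolevNorm (u t) < ⊤) ∧
  (∀ t ∈ Icc 0 T, Tendsto (fun s => R.sobolevNorm (u s - u t)) (𝓝[Icc 0 T] t) (𝓝 0)) ∧
  ∃ u' : ℝ → Lp ℂ 2 μ, ContinuousOn u' (Ioc 0 T) ∧ ∀ t ∈ Ioc 0 T,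
    HasDerivWithinAt u (u' t) (Icc 0 T) t ∧
    ∃ w, (u t, w) ∈ R.graph ∧ ∀ᵐ x ∂μ, u' t x + w x + (V x : ℂ) * u t x = 0

end L2

/-! ### Distributions and regularisations -/

/-- Distributions on `G`: linear forms on `𝒟(G)` which on functions supported in a compact set `K`
are bounded by finitely many of the seminorms `sup |X_{i_1} ⋯ X_{i_l} φ|`. -/
structure GroupDistribution (gr : Gradation n G) where
  toLin : testFunctions n G →ₗ[ℂ] ℂ
  bounded : ∀ K : Set G, IsCompact K → ∃ (C : ℝ) (m : ℕ), ∀ φ : testFunctions n G,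
    tsupport (φ : G → ℂ) ⊆ K → ∀ B : ℝ,
    (∀ l : List (Fin n), l.length ≤ m →
      ∀ x, ‖l.foldr (fun i g => leftDeriv (gr.basis i) g) (φ : G → ℂ) x‖ ≤ B) →
    ‖toLin φ‖ ≤ C * B

namespace GroupDistribution

variable {gr : Gradation n G} (v : GroupDistribution gr)

open Classical in
/-- The value `⟨v, φ⟩`, with value `0` when `φ` is not a test function. -/
def eval (φ : G → ℂ) : ℂ := if h : φ ∈ testFunctions n G then v.toLin ⟨φ, h⟩ else 0

/-- `v ≥ 0`. -/
def Nonneg : Prop := ∀ φ ∈ testFunctions n G, (∀ x, 0 ≤ φ x) → 0 ≤ v.eval φ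

/-- `v ∈ ℰ'(G)`. -/
def HasCompactSupp : Prop := ∃ K : Set G, IsCompact K ∧
  ∀ φ ∈ testFunctions n G, Disjoint (tsupport φ) K → v.eval φ = 0

/-- `v` is the regular distribution of the function `f`. -/
def IsRegular [MeasurableSpace G] (μ : Measure G) (f : G → ℂ) : Prop :=
  ∀ φ ∈ testFunctions n G, v.eval φ = ∫ x, f x * φ x ∂μ

/-- `v ∈ L^p(G)`. -/
def MemLebesgue [MeasurableSpace G] (p : ℝ≥0∞) (μ : Measure G) : Prop :=
  ∃ f, MemLp f p μ ∧ v.IsRegular μ f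

/-- `v ∈ H^{ν/2}(G)`. -/
def MemSobolev [MeasurableSpace G] {μ : Measure G} (R : PositiveRockland gr μ) : Prop :=
  ∃ f : Lp ℂ 2 μ, R.sobolevNorm f < ⊤ ∧ v.IsRegular μ f

/-- The convolution `(v * ψ)(x) = ⟨v, y ↦ ψ(y⁻¹ x)⟩`. -/
def conv (ψ : G → ℂ) (x : G) : ℂ := v.eval fun y => ψ (y⁻¹ * x)

end GroupDistribution

/-- A scale: a positive function of `ε ∈ (0, 1]` which tends to `0` as `ε → 0`. -/
def IsScale (ρ : ℝ → ℝ) : Prop :=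
  (∀ ε ∈ Ioc (0 : ℝ) 1, 0 < ρ ε) ∧ Tendsto ρ (𝓝[>] 0) (𝓝 0)

/-- The net `f ε = v * ψ_ε`, `ψ_ε(x) = θ(ε)^{-Q} ψ(D_{θ(ε)⁻¹} x)`, for some Friedrichs mollifier
`ψ` and some scale `θ`. -/
def IsRegularisation [MeasurableSpace G] {μ : Measure G} {gr : Gradation n G}
    (v : GroupDistribution gr) (f : ℝ → Lp ℂ 2 μ) : Prop :=
  ∃ ψ ∈ testFunctions n G, ∫ x, ψ x ∂μ = 1 ∧ ∃ θ : ℝ → ℝ, IsScale θ ∧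
    ∀ ε ∈ Ioc (0 : ℝ) 1, f ε =ᵐ[μ]
      v.conv fun x => (((θ ε) ^ gr.homDim)⁻¹ : ℝ) * ψ (gr.dilation (θ ε)⁻¹ x)

end GradedGroup

/-! ### Moderate and negligible nets

A normed space of functions is given by its norm, extended by `∞` outside of the space. -/

/-- `‖f_ε‖ ≤ C ρ(ε)^{-N}` for some `N`, `C` and all `ε ∈ (0, 1]`. -/
def IsModerate {X : Type*} (ρ : ℝ → ℝ) (nrm : X → ℝ≥0∞) (f : ℝ → X) : Prop :=
  ∃ (N : ℕ) (C : ℝ), ∀ ε ∈ Ioc (0 : ℝ) 1, nrm (f ε) ≤ ENNReal.ofReal (C * ((ρ ε) ^ N)⁻¹)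

/-- For every `k` there is `C` with `‖f_ε‖ ≤ C ρ(ε)^k` for all `ε ∈ (0, 1]`. -/
def IsNegligible {X : Type*} (ρ : ℝ → ℝ) (nrm : X → ℝ≥0∞) (f : ℝ → X) : Prop :=
  ∀ k : ℕ, ∃ C : ℝ, ∀ ε ∈ Ioc (0 : ℝ) 1, nrm (f ε) ≤ ENNReal.ofReal (C * (ρ ε) ^ k)

open Classical in
/-- The norm of `L^p`, with value `∞` outside of `L^p`. -/
def lebesgueNorm {G : Type*} [MeasurableSpace G] (p : ℝ≥0∞) (μ : Measure G) (f : G → ℝ) : ℝ≥0∞ :=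
  if AEStronglyMeasurable f μ then eLpNorm f p μ else ⊤

/-- The norm of `L^p ∩ L^q`, with value `∞` outside of `L^p ∩ L^q`. -/
def lebesgueInterNorm {G : Type*} [MeasurableSpace G] (p q : ℝ≥0∞) (μ : Measure G) (f : G → ℝ) :
    ℝ≥0∞ :=
  lebesgueNorm p μ f + lebesgueNorm q μ f

section HeatProblem

variable {n : ℕ} {G : Type*} [TopologicalSpace G] [ChartedSpace (EuclideanSpace ℝ (Fin n)) G]
  [Group G] [MeasurableSpace G]

/-- The Cauchy problem `∂_t u + ℛ u + V u = 0` on `[0, T] × G`, `u(0) = u₀`, with distributional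
`V` and `u₀`. -/
structure HeatProblem {gr : Gradation n G} {μ : Measure G} (R : PositiveRockland gr μ) where
  T : ℝ
  T_pos : 0 < T
  V : GroupDistribution gr
  u₀ : GroupDistribution gr

/-- The `(X, Y)`-uniqueness of the very weak solution in the case of a nonnegative potential, at
the scale `ρ`; `X` and `Y` are given by their norms. The nets of nonnegative potentials `V ε`,
`V' ε` are not required to approximate `V`. The net `u₀ ε` is a regularisation of the initial
datum and `u₀' ε` is any moderate net, for instance another regularisation, which
differs from it by a negligible net. -/
def HeatProblem.IsUniqueVeryWeak {gr : Gradation n G} {μ : Measure G} {R : PositiveRockland gr μ}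
    (P : HeatProblem R) (ρ : ℝ → ℝ) (X Y : (G → ℝ) → ℝ≥0∞) : Prop :=
  ∀ (V V' : ℝ → G → ℝ) (u₀ u₀' : ℝ → Lp ℂ 2 μ) (u u' : ℝ → ℝ → Lp ℂ 2 μ),
    (∀ ε ∈ Ioc (0 : ℝ) 1, (∀ᵐ x ∂μ, 0 ≤ V ε x) ∧ ∀ᵐ x ∂μ, 0 ≤ V' ε x) →
    IsModerate ρ X V → IsModerate ρ X V' → IsNegligible ρ Y (V - V') →
    IsRegularisation P.u₀ u₀ →
    IsModerate ρ R.sobolevNorm u₀ → IsModerate ρ R.sobolevNorm u₀' →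
    IsNegligible ρ (fun f : Lp ℂ 2 μ => ‖f‖ₑ) (u₀ - u₀') →
    (∀ ε ∈ Ioc (0 : ℝ) 1, R.IsSolution P.T (V ε) (u₀ ε) (u ε)) →
    (∀ ε ∈ Ioc (0 : ℝ) 1, R.IsSolution P.T (V' ε) (u₀' ε) (u' ε)) →
    IsNegligible ρ (fun w : ℝ → Lp ℂ 2 μ => ⨆ t ∈ Icc 0 P.T, ‖w t‖ₑ) (u - u')

end HeatProblem

end

/-!
The theorem is an energy estimate. If `u`, `u'` solve the equation with potentials `V, V' ≥ 0` and
data `u₀`, `u₀'`, then `w = u - u'` satisfies `∂ₜw + ℛw + Vw + (V - V')u' = 0`. Since `ℛ ≥ 0` and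
`V ≥ 0`, pairing with `w` gives `Re⟨∂ₜw, w⟩ ≤ ‖V - V'‖_∞ ‖u'‖ ‖w‖`, hence
`‖w(t)‖ ≤ ‖w(0)‖ + t ‖V - V'‖_∞ sup ‖u'‖`; the same argument for `u'` alone gives
`‖u'(t)‖ ≤ ‖u₀'‖`. Altogether
`‖u(t) - u'(t)‖ ≤ ‖u₀ - u₀'‖ + t ‖V - V'‖_∞ ‖u₀'‖` (`PositiveRockland.IsSolution.norm_sub_le`),
and the right-hand side is negligible, because a negligible net times a moderate one is negligible.
The bound depends on `V` and `V'` only through their sign and `‖V - V'‖_∞`, so that both parts are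
instances of `HeatProblem.isUniqueVeryWeak_of_scale`, in which the space `X` is arbitrary.

The operator enters only through the graph `R.graph`, the closure of `ℛ` on test functions: the
graph is closed under differences (`PositiveRockland.sub_mem_graph`), which needs the additivity of
`∑ c_α X^α` on smooth functions and hence the smoothness of left-invariant derivatives, and
`⟨f, ℛf⟩ ≥ 0` passes to the closure (`PositiveRockland.inner_nonneg_of_mem_graph`). All pairings are
taken in the real inner product of `L²(G; ℂ)`, which is the real part of the complex one.
-/

/-! ### Left-invariant differential operators on smooth functions -/

section LeftDeriv

variable {n : ℕ} {G : Type*} [TopologicalSpace G] [ChartedSpace (EuclideanSpace ℝ (Fin n)) G]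
  [Group G]

/-- Left-invariant vector fields are smooth: they are the image under the differential of the
multiplication `G × G → G` of the smooth section `g ↦ (0, X)` of `T_g G × T_1 G`. The Mathlib lemma
`contMDiff_mulInvariantVectorField` gives `C²` only, which does not suffice to iterate
derivatives. -/
theorem contMDiff_infty_mulInvariantVectorField [LieGroup (𝓡 n) ∞ G]
    (X : GroupLieAlgebra (𝓡 n) G) :
    ContMDiff (𝓡 n) (𝓡 n).tangent ∞
      (fun g : G => (⟨g, mulInvariantVectorField X g⟩ : TangentBundle (𝓡 n) G)) := by
  have hmul : ContMDiff ((𝓡 n).prod (𝓡 n)) (𝓡 n) ∞ fun p : G × G => p.1 * p.2 :=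
    contMDiff_mul (𝓡 n) ∞
  have : IsManifold (𝓡 n) ((∞ : ℕ∞ω) + 1) G := inferInstanceAs (IsManifold (𝓡 n) ∞ G)
  let fg : G → TangentBundle (𝓡 n) G := fun g => ⟨g, 0⟩
  have sfg : ContMDiff (𝓡 n) (𝓡 n).tangent ∞ fg := Bundle.contMDiff_zeroSection _ _
  let fv : G → TangentBundle (𝓡 n) G := fun _ => ⟨1, X⟩
  have sfv : ContMDiff (𝓡 n) (𝓡 n).tangent ∞ fv := contMDiff_const
  have S₂ : ContMDiff ((𝓡 n).tangent.prod (𝓡 n).tangent) ((𝓡 n).prod (𝓡 n)).tangent ∞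
      (equivTangentBundleProd (𝓡 n) G (𝓡 n) G).symm := contMDiff_equivTangentBundleProd_symm
  have S₃ := hmul.contMDiff_tangentMap (m := ∞) le_rfl
  convert! (S₃.comp S₂).comp (sfg.prodMk sfv) with g
  · simp [fg, fv]
  · simp only [Function.comp_apply, tangentMap, fg, fv]
    rw [mfderiv_prod_eq_add_apply (hmul.mdifferentiableAt (by simp))]
    change mfderiv (𝓡 n) (𝓡 n) (g * ·) 1 X =
      mfderiv (𝓡 n) (𝓡 n) (· * 1) g 0 + mfderiv (𝓡 n) (𝓡 n) (g * ·) 1 X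
    rw [map_zero]
    exact (zero_add (M := EuclideanSpace ℝ (Fin n)) _).symm

theorem contMDiff_leftDeriv [LieGroup (𝓡 n) ∞ G] (X : GroupLieAlgebra (𝓡 n) G) {f : G → ℂ}
    (hf : ContMDiff (𝓡 n) 𝓘(ℝ, ℂ) ∞ f) : ContMDiff (𝓡 n) 𝓘(ℝ, ℂ) ∞ (leftDeriv X f) := by
  have : IsManifold (𝓡 n) ((∞ : ℕ∞ω) + 1) G := inferInstanceAs (IsManifold (𝓡 n) ∞ G)
  exact (contMDiff_snd_tangentBundle_modelSpace ℂ 𝓘(ℝ, ℂ)).comp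
    ((hf.contMDiff_tangentMap (m := ∞) le_rfl).comp (contMDiff_infty_mulInvariantVectorField X))

theorem leftDeriv_sub (X : GroupLieAlgebra (𝓡 n) G) {f g : G → ℂ}
    (hf : ContMDiff (𝓡 n) 𝓘(ℝ, ℂ) ∞ f) (hg : ContMDiff (𝓡 n) 𝓘(ℝ, ℂ) ∞ g) :
    leftDeriv X (f - g) = leftDeriv X f - leftDeriv X g := by
  ext x
  simp only [leftDeriv, Pi.sub_apply]
  rw [mfderiv_sub (hf.mdifferentiableAt (by simp)) (hg.mdifferentiableAt (by simp))]
  rfl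

theorem iterate_leftDeriv_sub [LieGroup (𝓡 n) ∞ G] (X : GroupLieAlgebra (𝓡 n) G) (k : ℕ)
    {f g : G → ℂ} (hf : ContMDiff (𝓡 n) 𝓘(ℝ, ℂ) ∞ f) (hg : ContMDiff (𝓡 n) 𝓘(ℝ, ℂ) ∞ g) :
    (leftDeriv X)^[k] (f - g) = (leftDeriv X)^[k] f - (leftDeriv X)^[k] g := by
  induction k generalizing f g with
  | zero => rfl
  | succ k ih =>
    simp only [Function.iterate_succ_apply]
    rw [leftDeriv_sub X hf hg, ih (contMDiff_leftDeriv X hf) (contMDiff_leftDeriv X hg)]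

theorem contMDiff_iterate_leftDeriv [LieGroup (𝓡 n) ∞ G] (X : GroupLieAlgebra (𝓡 n) G) (k : ℕ)
    {f : G → ℂ} (hf : ContMDiff (𝓡 n) 𝓘(ℝ, ℂ) ∞ f) :
    ContMDiff (𝓡 n) 𝓘(ℝ, ℂ) ∞ ((leftDeriv X)^[k] f) := by
  induction k generalizing f with
  | zero => exact hf
  | succ k ih => exact ih (contMDiff_leftDeriv X hf)

variable [LieGroup (𝓡 n) ∞ G] (gr : Gradation n G)

theorem Gradation.monomialOp_sub (α : Fin n →₀ ℕ) {f g : G → ℂ}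
    (hf : ContMDiff (𝓡 n) 𝓘(ℝ, ℂ) ∞ f) (hg : ContMDiff (𝓡 n) 𝓘(ℝ, ℂ) ∞ g) :
    gr.monomialOp α (f - g) = gr.monomialOp α f - gr.monomialOp α g := by
  have smooth (l : List (Fin n)) {f : G → ℂ} (hf : ContMDiff (𝓡 n) 𝓘(ℝ, ℂ) ∞ f) :
      ContMDiff (𝓡 n) 𝓘(ℝ, ℂ) ∞
        (l.foldr (fun i g => (leftDeriv (gr.basis i))^[α i] g) f) := by
    induction l with
    | nil => exact hf
    | cons i l ih => exact contMDiff_iterate_leftDeriv _ _ ih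
  unfold Gradation.monomialOp
  induction List.finRange n with
  | nil => rfl
  | cons i l ih =>
    simp only [List.foldr_cons]
    rw [ih, iterate_leftDeriv_sub _ _ (smooth l hf) (smooth l hg)]

theorem Gradation.diffOp_sub (c : (Fin n →₀ ℕ) →₀ ℂ) {f g : G → ℂ}
    (hf : ContMDiff (𝓡 n) 𝓘(ℝ, ℂ) ∞ f) (hg : ContMDiff (𝓡 n) 𝓘(ℝ, ℂ) ∞ g) :
    gr.diffOp c (f - g) = gr.diffOp c f - gr.diffOp c g := by
  ext x
  simp only [Gradation.diffOp, gr.monomialOp_sub _ hf hg, Pi.sub_apply, mul_sub, Finsupp.sum,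
    Finset.sum_sub_distrib]

end LeftDeriv

/-! ### Monotonicity of the Rockland operator -/

section Graph

variable {n : ℕ} {G : Type*} [TopologicalSpace G] [ChartedSpace (EuclideanSpace ℝ (Fin n)) G]
  [Group G] [MeasurableSpace G] {μ : Measure G} {gr : Gradation n G}

theorem PositiveRockland.sub_mem_graph [LieGroup (𝓡 n) ∞ G] (R : PositiveRockland gr μ)
    {p q : Lp ℂ 2 μ × Lp ℂ 2 μ} (hp : p ∈ R.graph) (hq : q ∈ R.graph) : p - q ∈ R.graph := by
  refine map_mem_closure₂ continuous_sub hp hq ?_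
  rintro a ⟨φ, hφ, h1, h2⟩ b ⟨ψ, hψ, h3, h4⟩
  refine ⟨φ - ψ, sub_mem hφ hψ, ?_, ?_⟩
  · exact (Lp.coeFn_sub _ _).trans (h1.sub h3)
  · rw [gr.diffOp_sub _ hφ.1 hψ.1]
    exact (Lp.coeFn_sub _ _).trans (h2.sub h4)

theorem PositiveRockland.inner_nonneg_of_mem_graph (R : PositiveRockland gr μ)
    {p : Lp ℂ 2 μ × Lp ℂ 2 μ} (hp : p ∈ R.graph) : 0 ≤ inner ℝ p.1 p.2 := by
  have hc : IsClosed {p : Lp ℂ 2 μ × Lp ℂ 2 μ | 0 ≤ inner ℝ p.1 p.2} :=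
    isClosed_le continuous_const (continuous_fst.inner continuous_snd)
  refine closure_minimal ?_ hc hp
  rintro ⟨a, b⟩ ⟨φ, hφ, h1, h2⟩
  have h : inner ℂ a b = ∫ x, gr.diffOp R.coeff φ x * conj (φ x) ∂μ := by
    rw [L2.inner_def]
    refine integral_congr_ae ?_
    filter_upwards [h1, h2] with x hx1 hx2
    rw [hx1, hx2, RCLike.inner_apply]
  have h' : inner ℝ a b = (inner ℂ a b).re := by
    rw [L2.inner_def, L2.inner_def]
    exact integral_re (L2.integrable_inner (𝕜 := ℂ) a b)
  change 0 ≤ inner ℝ a b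
  rw [h', h]
  exact (Complex.nonneg_iff.1 (R.positive φ hφ)).1

theorem PositiveRockland.enorm_le_sobolevNorm (R : PositiveRockland gr μ) (f : Lp ℂ 2 μ) :
    ‖f‖ₑ ≤ R.sobolevNorm f := by
  unfold PositiveRockland.sobolevNorm
  split_ifs
  · exact le_add_self
  · exact le_top

end Graph

/-! ### Energy estimates -/

/-- If `w` satisfies `½ d/dt ‖w‖² ≤ a ‖w‖`, then `‖w‖` grows at most at the rate `a`. -/
theorem norm_le_norm_add_mul_of_inner_deriv_le {E : Type*} [NormedAddCommGroup E]
    [InnerProductSpace ℝ E] {T a : ℝ} (ha : 0 ≤ a) {w w' : ℝ → E} (hc : ContinuousOn w (Icc 0 T))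
    (hd : ∀ t ∈ Ioo 0 T, HasDerivAt w (w' t) t)
    (hw : ∀ t ∈ Ioo 0 T, inner ℝ (w t) (w' t) ≤ a * ‖w t‖) {t : ℝ} (ht : t ∈ Icc 0 T) :
    ‖w t‖ ≤ ‖w 0‖ + a * t := by
  -- `‖w‖` need not be differentiable at the zeros of `w`, so it is replaced by `√(‖w‖ ^ 2 + δ)`.
  have key (δ : ℝ) (hδ : 0 < δ) : ‖w t‖ ≤ √(‖w 0‖ ^ 2 + δ) + a * t := by
    have hpos (s : ℝ) : 0 < ‖w s‖ ^ 2 + δ := by positivity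
    have hder : ∀ s ∈ Ioo 0 T, HasDerivAt (fun s => √(‖w s‖ ^ 2 + δ) - a * s)
        (2 * inner ℝ (w s) (w' s) / (2 * √(‖w s‖ ^ 2 + δ)) - a * 1) s := fun s hs =>
      (((hd s hs).norm_sq.add_const δ).sqrt (hpos s).ne').sub ((hasDerivAt_id s).const_mul a)
    have hanti : AntitoneOn (fun s => √(‖w s‖ ^ 2 + δ) - a * s) (Icc 0 T) := by
      refine antitoneOn_of_deriv_nonpos (convex_Icc 0 T)
        ((((hc.norm.pow 2).add continuousOn_const).sqrt).sub (by fun_prop)) ?_ ?_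
      · rw [interior_Icc]
        exact fun s hs => (hder s hs).differentiableAt.differentiableWithinAt
      · rw [interior_Icc]
        intro s hs
        have hle : ‖w s‖ ≤ √(‖w s‖ ^ 2 + δ) := Real.le_sqrt_of_sq_le (by linarith)
        rw [(hder s hs).deriv, mul_div_mul_left _ _ two_ne_zero, mul_one, sub_nonpos,
          div_le_iff₀ (Real.sqrt_pos.2 (hpos s))]
        exact (hw s hs).trans (mul_le_mul_of_nonneg_left hle ha)
    have h := hanti ⟨le_rfl, ht.1.trans ht.2⟩ ht ht.1
    have hle : ‖w t‖ ≤ √(‖w t‖ ^ 2 + δ) := Real.le_sqrt_of_sq_le (by linarith)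
    simp only [mul_zero, sub_zero] at h
    linarith
  have hlim : Tendsto (fun δ : ℝ => √(‖w 0‖ ^ 2 + δ) + a * t) (𝓝[>] 0) (𝓝 (‖w 0‖ + a * t)) := by
    have : ContinuousAt (fun δ : ℝ => √(‖w 0‖ ^ 2 + δ) + a * t) 0 := by fun_prop
    simpa using this.tendsto.mono_left nhdsWithin_le_nhds
  exact ge_of_tendsto hlim (eventually_mem_nhdsWithin.mono fun δ hδ => key δ hδ)

/-- Multiplication by a nonnegative function is positive. Neither boundedness nor measurability of
`V` is needed, because `h`, the product `V f`, is assumed to lie in `L²`. -/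
theorem inner_nonneg_of_ae_eq_mul {α : Type*} [MeasurableSpace α] {μ : Measure α} {V : α → ℝ}
    (hV : ∀ᵐ x ∂μ, 0 ≤ V x) {f h : Lp ℂ 2 μ} (hh : ∀ᵐ x ∂μ, h x = V x * f x) :
    0 ≤ inner ℝ f h := by
  rw [L2.inner_def]
  refine integral_nonneg_of_ae ?_
  filter_upwards [hV, hh] with x hx hx'
  rw [hx', ← Complex.real_smul, real_inner_smul_right]
  exact mul_nonneg hx real_inner_self_nonneg

section Solution

variable {n : ℕ} {G : Type*} [TopologicalSpace G] [ChartedSpace (EuclideanSpace ℝ (Fin n)) G]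
  [Group G] [MeasurableSpace G] {μ : Measure G} {gr : Gradation n G} {R : PositiveRockland gr μ}
  {T : ℝ} {V V' : G → ℝ} {u₀ u₀' : Lp ℂ 2 μ} {u u' : ℝ → Lp ℂ 2 μ}

/-- Continuity in `H^{ν/2}` implies continuity in `L²`. -/
theorem PositiveRockland.IsSolution.continuousOn (h : R.IsSolution T V u₀ u) :
    ContinuousOn u (Icc 0 T) := by
  intro t ht
  rw [ContinuousWithinAt, tendsto_iff_edist_tendsto_0]
  refine tendsto_of_tendsto_of_tendsto_of_le_of_le tendsto_const_nhds (h.2.2.1 t ht)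
    (fun _ => zero_le) fun s => ?_
  rw [edist_eq_enorm_sub]
  exact R.enorm_le_sobolevNorm _

theorem PositiveRockland.IsSolution.norm_le (h : R.IsSolution T V u₀ u)
    (hV : ∀ᵐ x ∂μ, 0 ≤ V x) {t : ℝ} (ht : t ∈ Icc 0 T) : ‖u t‖ ≤ ‖u₀‖ := by
  have hcont := h.continuousOn
  obtain ⟨h0, -, -, v, -, hv⟩ := h
  have := norm_le_norm_add_mul_of_inner_deriv_le le_rfl hcont
    (fun t ht => (hv t ⟨ht.1, ht.2.le⟩).1.hasDerivAt (Icc_mem_nhds ht.1 ht.2)) (fun t ht => ?_) ht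
  · simpa [h0] using this
  obtain ⟨-, w, hw, heq⟩ := hv t ⟨ht.1, ht.2.le⟩
  have h1 := R.inner_nonneg_of_mem_graph hw
  -- By the equation, `V u = -(∂ₜu + ℛu)`, so that `V u` lies in `L²`.
  have h2 : 0 ≤ inner ℝ (u t) (-(v t + w)) := by
    refine inner_nonneg_of_ae_eq_mul hV ?_
    filter_upwards [heq, Lp.coeFn_neg (v t + w), Lp.coeFn_add (v t) w] with x hx hx1 hx2
    rw [hx1, Pi.neg_apply, hx2, Pi.add_apply]
    linear_combination -hx
  rw [inner_neg_right, inner_add_right] at h2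
  simp only at h1
  linarith

/-- Stability of the solution with respect to the initial datum and the potential. -/
theorem PositiveRockland.IsSolution.norm_sub_le [LieGroup (𝓡 n) ∞ G]
    (h : R.IsSolution T V u₀ u) (h' : R.IsSolution T V' u₀' u')
    (hV : ∀ᵐ x ∂μ, 0 ≤ V x) (hV' : ∀ᵐ x ∂μ, 0 ≤ V' x) {M : ℝ} (hM : 0 ≤ M)
    (hm : AEStronglyMeasurable (V - V') μ) (hVV' : ∀ᵐ x ∂μ, |V x - V' x| ≤ M)
    {t : ℝ} (ht : t ∈ Icc 0 T) : ‖u t - u' t‖ ≤ ‖u₀ - u₀'‖ + M * ‖u₀'‖ * t := by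
  have hcont := h.continuousOn.sub h'.continuousOn
  have hbound : ∀ t ∈ Icc 0 T, ‖u' t‖ ≤ ‖u₀'‖ := fun t ht => h'.norm_le hV' ht
  obtain ⟨h0, -, -, v, -, hv⟩ := h
  obtain ⟨h0', -, -, v', -, hv'⟩ := h'
  have := norm_le_norm_add_mul_of_inner_deriv_le (a := M * ‖u₀'‖) (by positivity) hcont
    (fun t ht => ((hv t ⟨ht.1, ht.2.le⟩).1.sub (hv' t ⟨ht.1, ht.2.le⟩).1).hasDerivAt
      (Icc_mem_nhds ht.1 ht.2)) (fun t ht => ?_) ht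
  · simpa [h0, h0'] using this
  obtain ⟨-, w, hw, heq⟩ := hv t ⟨ht.1, ht.2.le⟩
  obtain ⟨-, w', hw', heq'⟩ := hv' t ⟨ht.1, ht.2.le⟩
  have hg : 0 ≤ inner ℝ (u t - u' t) (w - w') :=
    R.inner_nonneg_of_mem_graph (R.sub_mem_graph hw hw')
  have hle : ∀ᵐ x ∂μ, ‖((V x - V' x : ℝ) : ℂ) * u' t x‖ ≤ M * ‖u' t x‖ := by
    filter_upwards [hVV'] with x hx
    rw [norm_mul, Complex.norm_real, Real.norm_eq_abs]
    exact mul_le_mul_of_nonneg_right hx (norm_nonneg _)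
  have hmem : MemLp (fun x => ((V x - V' x : ℝ) : ℂ) * u' t x) 2 μ :=
    (Lp.memLp (u' t)).of_le_mul
      ((Complex.continuous_ofReal.comp_aestronglyMeasurable hm).mul
        (Lp.aestronglyMeasurable (u' t))) hle
  -- `f` is the source term `(V - V') u'` in the equation for the difference.
  let f : Lp ℂ 2 μ := hmem.toLp _
  have hfn : ‖f‖ ≤ M * ‖u₀'‖ := by
    refine (Lp.norm_le_mul_norm_of_ae_le_mul (g := u' t) (c := M) ?_).trans
      (mul_le_mul_of_nonneg_left (hbound t ⟨ht.1.le, ht.2.le⟩) hM)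
    filter_upwards [hle, hmem.coeFn_toLp] with x hx hx1
    rwa [hx1]
  -- By the equations, `V (u - u') = -∂ₜ(u - u') - ℛ(u - u') - f`.
  have h2 : 0 ≤ inner ℝ (u t - u' t) (-(v t - v' t) - (w - w') - f) := by
    refine inner_nonneg_of_ae_eq_mul hV ?_
    filter_upwards [heq, heq', Lp.coeFn_sub (-(v t - v' t) - (w - w')) f,
      Lp.coeFn_sub (-(v t - v' t)) (w - w'), Lp.coeFn_neg (v t - v' t), Lp.coeFn_sub (v t) (v' t),
      Lp.coeFn_sub w w', Lp.coeFn_sub (u t) (u' t), hmem.coeFn_toLp] with x e1 e2 a1 a2 a3 a4 a5 a6 a7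
    rw [a1, Pi.sub_apply, a2, Pi.sub_apply, a3, Pi.neg_apply, a4, Pi.sub_apply, a5, Pi.sub_apply,
      a6, Pi.sub_apply, a7]
    push_cast
    linear_combination e2 - e1
  have h3 : -inner ℝ (u t - u' t) f ≤ ‖u t - u' t‖ * ‖f‖ :=
    (neg_le_abs _).trans (abs_real_inner_le_norm _ _)
  have h4 : ‖u t - u' t‖ * ‖f‖ ≤ ‖u t - u' t‖ * (M * ‖u₀'‖) :=
    mul_le_mul_of_nonneg_left hfn (norm_nonneg _)
  rw [inner_sub_right, inner_sub_right, inner_neg_right] at h2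
  change inner ℝ (u t - u' t) (v t - v' t) ≤ _ * ‖u t - u' t‖
  linarith

end Solution

/-! ### Negligible nets of solutions -/

theorem lebesgueNorm_top_le_ofReal {G : Type*} [MeasurableSpace G] {μ : Measure G} {f : G → ℝ}
    {M : ℝ} (hM : 0 ≤ M) (h : lebesgueNorm ⊤ μ f ≤ ENNReal.ofReal M) :
    AEStronglyMeasurable f μ ∧ ∀ᵐ x ∂μ, |f x| ≤ M := by
  unfold lebesgueNorm at h
  split_ifs at h with hf
  · refine ⟨hf, ?_⟩
    rw [eLpNorm_exponent_top] at h
    filter_upwards [enorm_ae_le_eLpNormEssSup f μ] with x hx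
    rw [← Real.norm_eq_abs]
    rw [← ENNReal.ofReal_le_ofReal_iff hM, ofReal_norm]
    exact hx.trans h
  · exact absurd h (by simp)

section HeatProblem

variable {n : ℕ} {G : Type*} [TopologicalSpace G] [ChartedSpace (EuclideanSpace ℝ (Fin n)) G]
  [Group G] [LieGroup (𝓡 n) ∞ G] [MeasurableSpace G]

/-- `(X, L^∞)`-uniqueness, for an arbitrary space `X` of potentials. -/
theorem HeatProblem.isUniqueVeryWeak_of_scale {gr : Gradation n G} {μ : Measure G}
    {R : PositiveRockland gr μ} (P : HeatProblem R) {ρ : ℝ → ℝ} (hρ : IsScale ρ)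
    (X : (G → ℝ) → ℝ≥0∞) : P.IsUniqueVeryWeak ρ X (lebesgueNorm ⊤ μ) := by
  intro V V' u₀ u₀' u u' hnn _ _ hVV' _ _ hmod hneg hu hu' k
  obtain ⟨N, C, hC⟩ := hmod
  obtain ⟨A, hA⟩ := hneg k
  -- The exponent `k + N` makes up for the growth `ρ(ε)^{-N}` of the data.
  obtain ⟨B, hB⟩ := hVV' (k + N)
  refine ⟨|A| + |B| * |C| * P.T, fun ε hε => iSup₂_le fun t ht => ?_⟩
  have hpos : 0 < ρ ε := hρ.1 ε hε
  have hu0 : ‖u₀' ε‖ ≤ |C| * (ρ ε ^ N)⁻¹ := by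
    have h := (R.enorm_le_sobolevNorm _).trans (hC ε hε)
    rw [← ofReal_norm] at h
    refine (ENNReal.ofReal_le_ofReal_iff (by positivity)).1 (h.trans (ENNReal.ofReal_le_ofReal ?_))
    gcongr
    exact le_abs_self C
  have hd0 : ‖u₀ ε - u₀' ε‖ ≤ |A| * ρ ε ^ k := by
    have h := hA ε hε
    simp only [Pi.sub_apply] at h
    rw [← ofReal_norm] at h
    refine (ENNReal.ofReal_le_ofReal_iff (by positivity)).1 (h.trans (ENNReal.ofReal_le_ofReal ?_))
    gcongr
    exact le_abs_self A
  have hM : 0 ≤ |B| * ρ ε ^ (k + N) := by positivity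
  obtain ⟨hm, hb⟩ := lebesgueNorm_top_le_ofReal hM ((hB ε hε).trans (ENNReal.ofReal_le_ofReal
    (mul_le_mul_of_nonneg_right (le_abs_self B) (by positivity))))
  have h := (hu ε hε).norm_sub_le (hu' ε hε) (hnn ε hε).1 (hnn ε hε).2 hM hm hb ht
  simp only [Pi.sub_apply]
  rw [← ofReal_norm]
  refine ENNReal.ofReal_le_ofReal (h.trans ?_)
  calc ‖u₀ ε - u₀' ε‖ + |B| * ρ ε ^ (k + N) * ‖u₀' ε‖ * t
      ≤ |A| * ρ ε ^ k + |B| * ρ ε ^ (k + N) * (|C| * (ρ ε ^ N)⁻¹) * P.T := by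
        have := ht.1
        have := ht.2
        gcongr
    _ = (|A| + |B| * |C| * P.T) * ρ ε ^ k := by
        rw [pow_add]
        field_simp

end HeatProblem

theorem mainTheorem3 {n : ℕ} {G : Type*} [TopologicalSpace G] [T2Space G]
    [SecondCountableTopology G] [ChartedSpace (EuclideanSpace ℝ (Fin n)) G] [Group G]
    [LieGroup (𝓡 n) ∞ G] [SimplyConnectedSpace G] [MeasurableSpace G] [BorelSpace G]
    (μ : Measure G) [μ.IsHaarMeasure] (gr : Gradation n G) (R : PositiveRockland gr μ)
    (P : HeatProblem R) (ρ : ℝ → ℝ) (hρ : IsScale ρ) (hV : P.V.Nonneg)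
    (hu₀ : P.u₀.MemSobolev R ∨ P.u₀.HasCompactSupp) :
    ((P.V.MemLebesgue ⊤ μ ∨ P.V.HasCompactSupp) →
      P.IsUniqueVeryWeak ρ (lebesgueNorm ⊤ μ) (lebesgueNorm ⊤ μ)) ∧
    (R.degree < gr.homDim →
      (P.V.MemLebesgue ⊤ μ ∨ P.V.HasCompactSupp ∨
        (P.V.MemLebesgue (ENNReal.ofReal (gr.homDim / R.degree)) μ ∧
          P.V.MemLebesgue (ENNReal.ofReal (2 * gr.homDim / R.degree)) μ)) →
      P.IsUniqueVeryWeak ρ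
        (lebesgueInterNorm (ENNReal.ofReal (gr.homDim / R.degree))
          (ENNReal.ofReal (2 * gr.homDim / R.degree)) μ)
        (lebesgueNorm ⊤ μ)) := by
  exact ⟨fun _ => P.isUniqueVeryWeak_of_scale hρ _, fun _ _ => P.isUniqueVeryWeak_of_scale hρ _⟩
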